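/- Let $\mathbb I=[-1,1]$, let $L_2=L_2(\mathbb I)$ be the real Lebesgue space with norm $\|\cdot\|_2$, and for $m\in\mathbb N$, $m\ge 1$, let $L_2^m$ be the space of functions $f:\mathbb I\to\mathbb R$ whose derivative $f^{(m-1)}$ exists and is absolutely continuous on $\mathbb I$ and for which $f^{(m)}\in L_2$. Let $r\ge 1$ and $0\le k\le r-1$ be integers, and put $W_2^r=\{f\in L_2^r:\|f^{(r)}\|_2\le 1\}$. For a linear functional $S:L_2\to\mathbb R$ and $N\ge 0$ let $$U(D^k_{-1};S;W_2^r)=\sup_{f\in W_2^r}\bigl|f^{(k)}(-1)-Sf\bigr|,\qquad E_N(D^k_{-1};W_2^r)=\inf_{\|S\|\le N}U(D^k_{-1};S;W_2^r)$$ (values in $[0,+\infty]$), where the infimum is over all linear functionals $S:L_2\to\mathbb R$ with operator norm at most $N$. Let $M_{-1}$ be the smallest constant with $|Q^{(k)}(-1)|\le M_{-1}\|Q\|_2$ for all real polynomials $Q$ of degree at most $r-1$. For $\lambda\ge 0$ let $u_\lambda\in L_2^{2r}$ be the solution of $$(-1)^ru^{(2r)}(x)+\lambda u(x)=0\quad(-1<x<1),\qquad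 u^{(s)}(-1)=(-1)^{k-1}\delta_{r-k-1,s},\quad u^{(s)}(1)=0\quad(s=0,1,\dots,r-1),$$ where $\delta_{i,j}$ is the Kronecker symbol. Theorem. For every $\lambda\ge 0$ the solution $u_\lambda$ exists and is unique. For $0\le N<M_{-1}$ one has $E_N(D^k_{-1};W_2^r)=+\infty$. For $N\ge M_{-1}$ there exists $\lambda_N\ge 0$ with $\|u_{\lambda_N}^{(r)}\|_2=N$, and for any such $\lambda_N$ the functional $$S_{N}f=\int_{-1}^1u_{\lambda_N}^{(r)}(x)f(x)\,dx,\qquad f\in L_2,$$ is a linear functional on $L_2$ with $\|S_N\|\le N$ and $$E_N(D^k_{-1};W_2^r)=U(D^k_{-1};S_N;W_2^r)=\|u_{\lambda_N}\|_2 .$$ -/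

import Mathlib

open MeasureTheory Set
open scoped ENNReal NNReal

namespace StechkinInterval

noncomputable section

/-- The interval `[-1, 1]`. -/
abbrev II : Set ℝ := Icc (-1) 1

/-- Lebesgue measure on `[-1, 1]`. -/
abbrev vol : Measure ℝ := volume.restrict II

/-- The real Hilbert space `L₂` on `[-1, 1]`. -/
abbrev L2 : Type := Lp ℝ 2 vol

/-- The `j`-th derivative of a function on `[-1, 1]` (one-sided at the end points). -/
abbrev D (j : ℕ) (f : ℝ → ℝ) : ℝ → ℝ := iteratedDerivWithin j f II

/-- The `L₂`-norm on `[-1, 1]`, as an extended nonnegative real. -/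
abbrev norm2 (f : ℝ → ℝ) : ℝ≥0∞ := eLpNorm f 2 vol

/-- The space `L₂^m` on `[-1, 1]`, for `m ≥ 1`: the derivative `f^(m-1)` exists and is absolutely
continuous on `[-1, 1]`, and `f^(m)` (which then exists almost everywhere) is in `L₂`. Only the
values of `f` on `[-1, 1]` matter. -/
structure MemSob (m : ℕ) (f : ℝ → ℝ) : Prop where
  contDiffOn : ContDiffOn ℝ ((m - 1 : ℕ) : ℕ∞) f II
  absCont : AbsolutelyContinuousOnInterval (D (m - 1) f) (-1) 1
  memLp : MemLp (D m f) 2 vol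

theorem MemSob.memLp_self {m : ℕ} {f : ℝ → ℝ} (hf : MemSob m f) : MemLp f 2 vol := by
  have hc : ContinuousOn f II := hf.contDiffOn.continuousOn
  obtain ⟨C, hC⟩ := isCompact_Icc.exists_bound_of_continuousOn hc
  exact MemLp.of_bound (hc.aestronglyMeasurable measurableSet_Icc) C
    ((ae_restrict_iff' measurableSet_Icc).2 (Filter.Eventually.of_forall hC))

/-- The class `W₂^r` of all `f ∈ L₂^r` with `‖f^(r)‖₂ ≤ 1`. -/
structure MemW (r : ℕ) (f : ℝ → ℝ) : Prop where
  memSob : MemSob r f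
  norm_le : norm2 (D r f) ≤ 1

/-- The error `U(D^k_{-1}; S; W₂^r)`, the supremum of `|f^(k)(-1) - S f|` over `f ∈ W₂^r`. -/
def approxError (r k : ℕ) (S : L2 → ℝ) : ℝ≥0∞ :=
  ⨆ (f : ℝ → ℝ) (hf : MemW r f), ‖D k f (-1) - S (hf.memSob.memLp_self.toLp f)‖ₑ

/-- The best approximation `E_N(D^k_{-1}; W₂^r)`, the infimum of the errors of the linear
functionals `S` on `L₂` with `‖S‖ ≤ N`. -/
def bestApprox (r k : ℕ) (N : ℝ≥0) : ℝ≥0∞ :=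
  ⨅ (S : L2 →L[ℝ] ℝ) (_ : ‖S‖ ≤ N), approxError r k S

/-- The sharp constant `M_{-1}` in the inequality `|Q^(k)(-1)| ≤ M_{-1} ‖Q‖₂` for real polynomials
`Q` of degree at most `r - 1`. -/
def markovConst (r k : ℕ) : ℝ≥0∞ :=
  sInf {M : ℝ≥0∞ | ∀ Q ∈ Polynomial.degreeLT ℝ r,
    ‖(Polynomial.derivative^[k] Q).eval (-1)‖ₑ ≤ M * norm2 (fun x => Q.eval x)}

/-- `u ∈ L₂^{2r}` solves `(-1)^r u^(2r) + μ u = 0` on `(-1, 1)`, with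
`u^(s)(-1) = (-1)^(k-1) δ_{r-k-1,s}` and `u^(s)(1) = 0` for `s = 0, …, r-1`. -/
structure IsSolution (r k : ℕ) (μ : ℝ) (u : ℝ → ℝ) : Prop where
  memSob : MemSob (2 * r) u
  eqn : ∀ x ∈ Ioo (-1 : ℝ) 1, (-1) ^ r * D (2 * r) u x + μ * u x = 0
  left : ∀ s < r, D s u (-1) = if r - k - 1 = s then (-1 : ℝ) ^ ((k : ℤ) - 1) else 0
  right : ∀ s < r, D s u 1 = 0

end

end StechkinInterval

open StechkinInterval

namespace StechkinInterval

/-! Let u solve the boundary value problem for μ ≥ 0 and put g = u^(r). Integrating by parts r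
times, the boundary data of u leave a single boundary term: f^(k)(-1) - ∫ g f = ± ∫ u f^(r). So the
functional f ↦ ∫ g f has norm ‖g‖ and, by Cauchy–Schwarz with equality when f^(r) is proportional to
u, error ‖u‖ (`approxError_integralFunctional`).

Optimality comes from testing with g itself. The equation gives g^(r) = ± μ u, and f = g in the
identity gives g^(k)(-1) = ‖g‖² + μ ‖u‖². If ‖S‖ ≤ ‖g‖, then S g ≤ ‖g‖², so for μ > 0 and u ≠ 0 the
error of S at g / (μ ‖u‖) is at least ‖u‖. For μ = 0 a functional of finite error is exact on g,
which forces S = ∫ g · (`IsSolution.nrm_le_approxError`). Exactness on polynomials of degree below r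
also gives M_{-1} ≤ ‖S‖, hence the case N < M_{-1}.

It remains to hit every level N ≥ M_{-1}. An energy identity gives uniqueness (`SolvesEqn.eqOn`);
finite dimension turns it into existence and continuity in μ. The norm ‖u_μ^(r)‖ is at most M_{-1}
at μ = 0 and is unbounded (`exists_le_nrm_D_extremal`), so the intermediate value theorem applies.
-/

theorem uniqueDiffOn_II : UniqueDiffOn ℝ II := uniqueDiffOn_Icc (by norm_num)

theorem left_mem_II : (-1 : ℝ) ∈ II := ⟨le_rfl, by norm_num⟩

theorem right_mem_II : (1 : ℝ) ∈ II := ⟨by norm_num, le_rfl⟩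

theorem D_succ (j : ℕ) (f : ℝ → ℝ) : D (j + 1) f = derivWithin (D j f) II :=
  iteratedDerivWithin_succ

theorem D_zero (f : ℝ → ℝ) : D 0 f = f := iteratedDerivWithin_zero

theorem D_D (i j : ℕ) (f : ℝ → ℝ) : D i (D j f) = D (i + j) f := by
  induction i with
  | zero => rw [D_zero, zero_add]
  | succ i ih => rw [D_succ, ih, show i + 1 + j = (i + j) + 1 by ring, D_succ]

/-- The end points are null, so the differential equation, known only on the open interval, suffices
under every integral. -/
theorem ae_vol_of_Ioo {p : ℝ → Prop} (h : ∀ x ∈ Ioo (-1 : ℝ) 1, p x) : ∀ᵐ x ∂vol, p x := by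
  rw [vol, ← restrict_Ioo_eq_restrict_Icc]
  exact (ae_restrict_iff' measurableSet_Ioo).2 (Filter.Eventually.of_forall h)

theorem integral_eq_vol (f : ℝ → ℝ) : ∫ x in (-1 : ℝ)..1, f x = ∫ x, f x ∂vol := by
  rw [intervalIntegral.integral_of_le (by norm_num), ← integral_Icc_eq_integral_Ioc]

theorem integral_congr_of_Ioo {f g : ℝ → ℝ} (h : ∀ x ∈ Ioo (-1 : ℝ) 1, f x = g x) :
    ∫ x in (-1 : ℝ)..1, f x = ∫ x in (-1 : ℝ)..1, g x := by
  rw [integral_eq_vol, integral_eq_vol]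
  exact integral_congr_ae (ae_vol_of_Ioo h)

theorem derivWithin_II_eq_deriv (f : ℝ → ℝ) {x : ℝ} (hx : x ∈ Ioo (-1 : ℝ) 1) :
    derivWithin f II x = deriv f x :=
  derivWithin_of_mem_nhds (Icc_mem_nhds hx.1 hx.2)

/-! ### Repeated integration by parts -/

theorem integral_derivWithin_mul {f g : ℝ → ℝ} (hf : AbsolutelyContinuousOnInterval f (-1) 1)
    (hg : AbsolutelyContinuousOnInterval g (-1) 1) :
    ∫ x in (-1 : ℝ)..1, derivWithin f II x * g x =
      f 1 * g 1 - f (-1) * g (-1) - ∫ x in (-1 : ℝ)..1, f x * derivWithin g II x := by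
  have h1 : ∫ x in (-1 : ℝ)..1, derivWithin f II x * g x =
      ∫ x in (-1 : ℝ)..1, deriv f x * g x :=
    integral_congr_of_Ioo fun x hx => by rw [derivWithin_II_eq_deriv f hx]
  have h2 : ∫ x in (-1 : ℝ)..1, f x * derivWithin g II x =
      ∫ x in (-1 : ℝ)..1, f x * deriv g x :=
    integral_congr_of_Ioo fun x hx => by rw [derivWithin_II_eq_deriv g hx]
  rw [h1, h2, hf.integral_mul_deriv_eq_deriv_mul hg]
  ring

/-- The derivatives of `f` of order less than `n` are absolutely continuous. -/
def ACUpTo (n : ℕ) (f : ℝ → ℝ) : Prop :=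
  ∀ j < n, AbsolutelyContinuousOnInterval (D j f) (-1) 1

theorem ACUpTo.mono {m n : ℕ} {f : ℝ → ℝ} (hf : ACUpTo n f) (h : m ≤ n) : ACUpTo m f :=
  fun j hj => hf j (hj.trans_le h)

theorem ACUpTo.D {m n : ℕ} {f : ℝ → ℝ} (hf : ACUpTo (n + m) f) : ACUpTo n (D m f) := by
  intro j hj
  rw [D_D]
  exact hf _ (by omega)

theorem contDiffOn_D {m j : ℕ} {f : ℝ → ℝ} (hf : ContDiffOn ℝ ((m + j : ℕ) : ℕ∞) f II) :
    ContDiffOn ℝ ((m : ℕ) : ℕ∞) (D j f) II :=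
by
  have h := (contDiffOn_nat_iff_continuousOn_differentiableOn_deriv (n := m + j)
    uniqueDiffOn_II).1 (by exact_mod_cast hf)
  have := (contDiffOn_nat_iff_continuousOn_differentiableOn_deriv (n := m) (f := D j f)
    uniqueDiffOn_II).2 ⟨fun i hi => ?_, fun i hi => ?_⟩
  · exact_mod_cast this
  · change ContinuousOn (D i (D j f)) II
    rw [D_D]
    exact h.1 (i + j) (by omega)
  · change DifferentiableOn ℝ (D i (D j f)) II
    rw [D_D]
    exact h.2 (i + j) (by omega)

theorem MemSob.acUpTo {m : ℕ} {f : ℝ → ℝ} (hf : MemSob m f) : ACUpTo m f := by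
  intro j hj
  rcases (show j ≤ m - 1 by omega).eq_or_lt with h | h
  · rw [h]; exact hf.absCont
  · apply ContDiffOn.absolutelyContinuousOnInterval
    rw [uIcc_of_le (by norm_num)]
    simpa using contDiffOn_D (m := 1) (j := j) (hf.contDiffOn.of_le (by norm_cast; omega))

theorem MemSob.continuousOn_D {m j : ℕ} {f : ℝ → ℝ} (hf : MemSob m f) (h : j < m) :
    ContinuousOn (D j f) II := by
  have := (hf.acUpTo j h).continuousOn
  rwa [uIcc_of_le (by norm_num)] at this

/-- Each step moves one derivative from w to f, so the induction applies its hypothesis to f'; the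
boundary terms pair orders adding up to r - 1. -/
theorem integral_D_mul {r : ℕ} {w f : ℝ → ℝ} (hw : ACUpTo r w) (hf : ACUpTo r f) :
    ∫ x in (-1 : ℝ)..1, D r w x * f x =
      ∑ j ∈ Finset.range r, (-1) ^ j *
        (D (r - 1 - j) w 1 * D j f 1 - D (r - 1 - j) w (-1) * D j f (-1)) +
      (-1) ^ r * ∫ x in (-1 : ℝ)..1, w x * D r f x := by
  induction r generalizing f with
  | zero => simp
  | succ r ih =>
    have h0 := integral_derivWithin_mul (hw r (by omega)) (hf 0 (by omega))
    rw [← D_succ, ← D_succ, D_zero, zero_add] at h0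
    rw [h0, ih (hw.mono (by omega)) hf.D, Finset.sum_range_succ']
    simp only [D_D]
    have : ∀ j ∈ Finset.range r, (-1 : ℝ) ^ (j + 1) *
        (D (r + 1 - 1 - (j + 1)) w 1 * D (j + 1) f 1 -
          D (r + 1 - 1 - (j + 1)) w (-1) * D (j + 1) f (-1)) =
        - ((-1) ^ j * (D (r - 1 - j) w 1 * D (j + 1) f 1 -
          D (r - 1 - j) w (-1) * D (j + 1) f (-1))) := by
      intro j _
      rw [show r + 1 - 1 - (j + 1) = r - 1 - j by omega, pow_succ]
      ring
    rw [Finset.sum_congr rfl this, Finset.sum_neg_distrib, pow_succ]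
    simp
    ring

theorem integral_D_mul_of_boundary_eq_zero {r : ℕ} {w f : ℝ → ℝ} (hw : ACUpTo r w)
    (hf : ACUpTo r f) (hl : ∀ s < r, D s w (-1) = 0) (hr : ∀ s < r, D s w 1 = 0) :
    ∫ x in (-1 : ℝ)..1, D r w x * f x = (-1) ^ r * ∫ x in (-1 : ℝ)..1, w x * D r f x := by
  rw [integral_D_mul hw hf, Finset.sum_eq_zero, zero_add]
  intro j hj
  rw [Finset.mem_range] at hj
  rw [hl _ (by omega), hr _ (by omega)]
  ring

/-- The boundary conditions of the functions `u_μ`. -/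
structure BoundaryCond (r k : ℕ) (w : ℝ → ℝ) : Prop where
  left : ∀ s < r, D s w (-1) = if r - k - 1 = s then (-1 : ℝ) ^ ((k : ℤ) - 1) else 0
  right : ∀ s < r, D s w 1 = 0

/-- Only the term j = k at -1 survives, and the factor (-1)^(k-1) in the data makes its coefficient
exactly 1. -/
theorem integral_D_mul_of_boundaryCond {r k : ℕ} (hk : k < r) {w f : ℝ → ℝ} (hw : ACUpTo r w)
    (hf : ACUpTo r f) (hb : BoundaryCond r k w) :
    ∫ x in (-1 : ℝ)..1, D r w x * f x =
      D k f (-1) + (-1) ^ r * ∫ x in (-1 : ℝ)..1, w x * D r f x := by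
  rw [integral_D_mul hw hf, Finset.sum_eq_single k]
  · rw [hb.left _ (by omega), hb.right _ (by omega), if_pos (by omega),
      zpow_sub₀ (by norm_num), zpow_natCast, zpow_one]
    have : (-1 : ℝ) ^ k * (-1) ^ k = 1 := by rw [← mul_pow]; norm_num
    linear_combination (D k f (-1)) * this
  · intro j hj hjk
    rw [Finset.mem_range] at hj
    rw [hb.left _ (by omega), hb.right _ (by omega), if_neg (by omega)]
    ring
  · intro h
    simp [hk] at h

/-- The `L₂`-norm on `[-1, 1]` as a real number. -/
noncomputable def nrm (f : ℝ → ℝ) : ℝ := √(∫ x in (-1 : ℝ)..1, f x ^ 2)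

theorem nrm_nonneg (f : ℝ → ℝ) : 0 ≤ nrm f := Real.sqrt_nonneg _

theorem nrm_sq (f : ℝ → ℝ) : nrm f ^ 2 = ∫ x in (-1 : ℝ)..1, f x ^ 2 :=
  Real.sq_sqrt (intervalIntegral.integral_nonneg (by norm_num) fun _ _ => sq_nonneg _)

theorem inner_toLp {f g : ℝ → ℝ} (hf : MemLp f 2 vol) (hg : MemLp g 2 vol) :
    inner ℝ (hf.toLp f) (hg.toLp g) = ∫ x in (-1 : ℝ)..1, f x * g x := by
  rw [L2.inner_def, integral_eq_vol]
  refine integral_congr_ae ?_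
  filter_upwards [hf.coeFn_toLp, hg.coeFn_toLp] with x h1 h2
  rw [h1, h2]
  simp [mul_comm]

theorem norm_toLp {f : ℝ → ℝ} (hf : MemLp f 2 vol) : ‖hf.toLp f‖ = nrm f := by
  have h := inner_toLp hf hf
  rw [real_inner_self_eq_norm_sq] at h
  rw [nrm, ← Real.sqrt_sq (norm_nonneg (hf.toLp f)), h]
  simp only [pow_two]

theorem norm2_eq {f : ℝ → ℝ} (hf : MemLp f 2 vol) : norm2 f = ENNReal.ofReal (nrm f) := by
  rw [← norm_toLp hf, Lp.norm_toLp, ENNReal.ofReal_toReal hf.eLpNorm_ne_top]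

theorem abs_integral_mul_le {f g : ℝ → ℝ} (hf : MemLp f 2 vol) (hg : MemLp g 2 vol) :
    |∫ x in (-1 : ℝ)..1, f x * g x| ≤ nrm f * nrm g := by
  rw [← inner_toLp hf hg, ← norm_toLp hf, ← norm_toLp hg]
  exact abs_real_inner_le_norm _ _

theorem memLp_of_continuousOn {f : ℝ → ℝ} (hf : ContinuousOn f II) : MemLp f 2 vol := by
  obtain ⟨C, hC⟩ := isCompact_Icc.exists_bound_of_continuousOn hf
  exact MemLp.of_bound (hf.aestronglyMeasurable measurableSet_Icc) C
    ((ae_restrict_iff' measurableSet_Icc).2 (Filter.Eventually.of_forall hC))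

theorem nrm_congr {f g : ℝ → ℝ} (h : ∀ x ∈ Ioo (-1 : ℝ) 1, f x = g x) : nrm f = nrm g := by
  rw [nrm, nrm, integral_congr_of_Ioo fun x hx => by rw [h x hx]]

theorem nrm_const_mul (c : ℝ) (f : ℝ → ℝ) : nrm (fun x => c * f x) = |c| * nrm f := by
  rw [nrm, nrm, ← Real.sqrt_sq_eq_abs, ← Real.sqrt_mul (sq_nonneg c),
    ← intervalIntegral.integral_const_mul]
  simp only [mul_pow]

theorem eqOn_zero_of_nrm_eq_zero {f : ℝ → ℝ} (hf : ContinuousOn f II) (h : nrm f = 0) :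
    EqOn f 0 II := by
  have h0 : ∫ x in (-1 : ℝ)..1, f x ^ 2 = 0 := by rw [← nrm_sq, h]; norm_num
  by_contra hne
  simp only [EqOn, not_forall] at hne
  obtain ⟨x, hx, hfx⟩ := hne
  have := intervalIntegral.integral_pos (a := -1) (b := 1) (f := fun x => f x ^ 2) (by norm_num)
    (hf.pow 2) (fun x _ => sq_nonneg _) ⟨x, hx, by
      have : f x ≠ 0 := hfx
      positivity⟩
  linarith

/-! ### Smoothness from a chain of derivatives -/

theorem D_eqOn_of_hasDerivWithinAt {n : ℕ} {F : ℕ → ℝ → ℝ}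
    (hF : ∀ j < n, ∀ x ∈ II, HasDerivWithinAt (F j) (F (j + 1) x) II x) {j : ℕ} (hj : j ≤ n) :
    EqOn (D j (F 0)) (F j) II := by
  induction j with
  | zero => intro x _; rw [D_zero]
  | succ j ih =>
    intro x hx
    rw [D_succ, derivWithin_congr (ih (by omega)) (ih (by omega) hx)]
    exact (hF j (by omega) x hx).derivWithin (uniqueDiffOn_II x hx)

theorem contDiffOn_of_hasDerivWithinAt {n : ℕ} {F : ℕ → ℝ → ℝ}
    (hF : ∀ j < n, ∀ x ∈ II, HasDerivWithinAt (F j) (F (j + 1) x) II x)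
    (hc : ContinuousOn (F n) II) : ContDiffOn ℝ (n : ℕ∞) (F 0) II := by
  have := (contDiffOn_nat_iff_continuousOn_differentiableOn_deriv (n := n) (f := F 0)
    uniqueDiffOn_II).2 ⟨fun m hm => ?_, fun m hm => ?_⟩
  · exact_mod_cast this
  · refine ContinuousOn.congr ?_ (D_eqOn_of_hasDerivWithinAt hF hm)
    rcases hm.eq_or_lt with rfl | hm
    · exact hc
    · exact fun x hx => (hF m hm x hx).continuousWithinAt
  · refine DifferentiableOn.congr ?_ (D_eqOn_of_hasDerivWithinAt hF hm.le)
    exact fun x hx => (hF m hm x hx).differentiableWithinAt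

theorem memSob_of_contDiffOn {n : ℕ} (hn : 1 ≤ n) {f : ℝ → ℝ}
    (hf : ContDiffOn ℝ (n : ℕ∞) f II) : MemSob n f where
  contDiffOn := hf.of_le (by norm_cast; omega)
  absCont := by
    apply ContDiffOn.absolutelyContinuousOnInterval
    rw [uIcc_of_le (by norm_num)]
    simpa using contDiffOn_D (m := 1) (j := n - 1) (hf.of_le (by norm_cast; omega))
  memLp := memLp_of_continuousOn
    (contDiffOn_D (m := 0) (j := n) (hf.of_le (by norm_cast; omega))).continuousOn

end StechkinInterval

/-! ### Errors of functionals, exactness on polynomials, and the Markov constant -/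

namespace StechkinInterval

theorem D_const_mul (c : ℝ) (j : ℕ) (f : ℝ → ℝ) :
    D j (fun x => c * f x) = fun x => c * D j f x := by
  induction j with
  | zero => simp only [D_zero]
  | succ j ih =>
    rw [D_succ, ih, D_succ]
    ext x
    exact derivWithin_const_mul_field c

theorem MemSob.const_mul {m : ℕ} {f : ℝ → ℝ} (hf : MemSob m f) (c : ℝ) :
    MemSob m (fun x => c * f x) where
  contDiffOn := contDiffOn_const.mul hf.contDiffOn
  absCont := by rw [D_const_mul]; exact hf.absCont.const_mul c
  memLp := by rw [D_const_mul]; exact hf.memLp.const_mul c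

theorem exists_memSob_D_eq {r : ℕ} (hr : 1 ≤ r) {g : ℝ → ℝ} (hg : ContinuousOn g II) :
    ∃ f, MemSob r f ∧ EqOn (D r f) g II := by
  obtain ⟨G, hG, hGg⟩ : ∃ G : ℝ → ℝ, Continuous G ∧ EqOn G g II := by
    have h : (-1 : ℝ) ≤ 1 := by norm_num
    refine ⟨IccExtend h (II.domRestrict g), hg.domRestrict.Icc_extend', fun x hx => ?_⟩
    rw [IccExtend_of_mem h _ hx]
    rfl
  -- The n-fold primitive of a continuous extension of g; the j-th derivative of `A r` is `A (r -
  -- j)`.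
  let A : ℕ → ℝ → ℝ := fun n => Nat.rec G (fun _ a x => ∫ t in (-1 : ℝ)..x, a t) n
  have hAs : ∀ j, A (j + 1) = fun x => ∫ t in (-1 : ℝ)..x, A j t := fun j => rfl
  have hA : ∀ j, Continuous (A j) := by
    intro j
    induction j with
    | zero => exact hG
    | succ j ih =>
      rw [hAs]
      exact intervalIntegral.continuous_primitive (fun a b => ih.intervalIntegrable a b) _
  have hd : ∀ j x, HasDerivAt (A (j + 1)) (A j x) x := by
    intro j x
    rw [hAs]
    exact intervalIntegral.integral_hasDerivAt_right ((hA j).intervalIntegrable _ _)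
      ((hA j).stronglyMeasurableAtFilter _ _) (hA j).continuousAt
  have hF : ∀ j < r, ∀ x ∈ II,
      HasDerivWithinAt (A (r - j)) (A (r - (j + 1)) x) II x := by
    intro j hj x _
    rw [show r - j = (r - (j + 1)) + 1 by omega]
    exact (hd _ x).hasDerivWithinAt
  refine ⟨A r, memSob_of_contDiffOn hr (contDiffOn_of_hasDerivWithinAt
    (F := fun j => A (r - j)) hF (hA _).continuousOn), fun x hx => ?_⟩
  have h := D_eqOn_of_hasDerivWithinAt (F := fun j => A (r - j)) hF le_rfl hx
  simp only [Nat.sub_zero, Nat.sub_self] at h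
  rw [h]
  exact hGg hx

theorem memW_of_nrm_le {r : ℕ} {f : ℝ → ℝ} (hf : MemSob r f) (h : nrm (D r f) ≤ 1) :
    MemW r f := by
  refine ⟨hf, ?_⟩
  rw [norm2_eq hf.memLp]
  exact ENNReal.ofReal_le_one.2 h

theorem MemW.nrm_le {r : ℕ} {f : ℝ → ℝ} (hf : MemW r f) : nrm (D r f) ≤ 1 := by
  have := hf.norm_le
  rwa [norm2_eq hf.memSob.memLp, ENNReal.ofReal_le_one] at this

theorem MemW.enorm_sub_le {r : ℕ} {f : ℝ → ℝ} (hf : MemW r f) (k : ℕ) (S : L2 → ℝ) :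
    ‖D k f (-1) - S (hf.memSob.memLp_self.toLp f)‖ₑ ≤ approxError r k S :=
  le_iSup₂ (f := fun (f : ℝ → ℝ) (hf : MemW r f) =>
    ‖D k f (-1) - S (hf.memSob.memLp_self.toLp f)‖ₑ) f hf

theorem apply_toLp_const_mul (S : L2 →L[ℝ] ℝ) {m : ℕ} {f : ℝ → ℝ} (hf : MemSob m f) (c : ℝ) :
    S ((hf.const_mul c).memLp_self.toLp _) = c * S (hf.memLp_self.toLp f) := by
  have : (hf.const_mul c).memLp_self.toLp _ = c • hf.memLp_self.toLp f := rfl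
  rw [this, map_smul, smul_eq_mul]

/-- A functional of finite error is exact on the functions whose `r`-th derivative vanishes. -/
theorem exact_of_approxError_ne_top {r k : ℕ} {S : L2 →L[ℝ] ℝ} (hS : approxError r k S ≠ ⊤)
    {f : ℝ → ℝ} (hf : MemSob r f) (h0 : nrm (D r f) = 0) :
    D k f (-1) = S (hf.memLp_self.toLp f) := by
  by_contra hne
  set d := D k f (-1) - S (hf.memLp_self.toLp f) with hd
  have hd0 : d ≠ 0 := sub_ne_zero.2 hne
  set C := (approxError r k S).toReal
  -- Scaling keeps the r-th derivative null, while this factor turns the defect d into C + 1, above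
  -- the error C.
  have hW : MemW r (fun x => (C + 1) / d * f x) := by
    refine memW_of_nrm_le (hf.const_mul _) ?_
    rw [D_const_mul, nrm_const_mul, h0, mul_zero]
    norm_num
  have h := hW.enorm_sub_le k S
  rw [apply_toLp_const_mul S hf, D_const_mul, ← mul_sub, ← hd, div_mul_cancel₀ _ hd0,
    ← ENNReal.ofReal_toReal hS, Real.enorm_eq_ofReal_abs,
    ENNReal.ofReal_le_ofReal_iff ENNReal.toReal_nonneg] at h
  have := le_abs_self (C + 1)
  change |C + 1| ≤ C at h
  linarith

theorem D_polynomial (Q : Polynomial ℝ) (j : ℕ) :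
    EqOn (D j fun x => Q.eval x) (fun x => (Polynomial.derivative^[j] Q).eval x) II := by
  refine D_eqOn_of_hasDerivWithinAt (n := j)
    (F := fun j x => (Polynomial.derivative^[j] Q).eval x) (fun i _ x _ => ?_) le_rfl
  simp only [Function.iterate_succ', Function.comp]
  exact (Polynomial.hasDerivAt _ x).hasDerivWithinAt

theorem memSob_polynomial {r : ℕ} (hr : 1 ≤ r) (Q : Polynomial ℝ) :
    MemSob r fun x => Q.eval x :=
  memSob_of_contDiffOn hr (by
    simpa [Polynomial.aeval_def, Polynomial.eval₂_id] using
      (Polynomial.contDiff_aeval (𝕜 := ℝ) Q (r : ℕ∞)).contDiffOn (s := II))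

/-- Exactness on polynomials of degree below r makes ‖S‖ an admissible constant in the Markov
inequality. -/
theorem markovConst_le_enorm {r k : ℕ} (hr : 1 ≤ r) {S : L2 →L[ℝ] ℝ}
    (hS : approxError r k S ≠ ⊤) : markovConst r k ≤ ‖S‖ₑ := by
  refine sInf_le fun Q hQ => ?_
  have hQs := memSob_polynomial hr Q
  have h0 : nrm (D r fun x => Q.eval x) = 0 := by
    rw [nrm_congr (g := fun _ => 0), nrm]
    · simp
    · intro x hx
      rw [D_polynomial Q r ⟨hx.1.le, hx.2.le⟩,
        Polynomial.iterate_derivative_eq_zero_of_degree_lt (Polynomial.mem_degreeLT.1 hQ)]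
      simp
  have h := exact_of_approxError_ne_top hS hQs h0
  rw [D_polynomial Q k left_mem_II] at h
  simp only at h
  rw [h]
  refine (S.le_opENorm _).trans_eq ?_
  rw [Lp.enorm_toLp]

/-- For such Q an admissible constant M satisfies ‖Q‖² ≤ M ‖Q‖; cancel ‖Q‖. -/
theorem nrm_le_markovConst {r k : ℕ} {Q : Polynomial ℝ} (hQ : Q ∈ Polynomial.degreeLT ℝ r)
    (h : (Polynomial.derivative^[k] Q).eval (-1) = nrm (fun x => Q.eval x) ^ 2) :
    ENNReal.ofReal (nrm fun x => Q.eval x) ≤ markovConst r k := by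
  refine le_sInf fun M hM => ?_
  have h1 := hM Q hQ
  rw [h, norm2_eq (memLp_of_continuousOn Q.continuous.continuousOn), enorm_pow,
    Real.enorm_of_nonneg (nrm_nonneg _), pow_two] at h1
  rcases (nrm_nonneg fun x => Q.eval x).eq_or_lt with h0 | h0
  · rw [← h0]; simp
  · exact (ENNReal.mul_le_mul_iff_left (by simpa using h0) ENNReal.ofReal_ne_top).1 h1

/-- The functional `f ↦ ∫ g f`. -/
noncomputable def integralFunctional {g : ℝ → ℝ} (hg : MemLp g 2 vol) : L2 →L[ℝ] ℝ :=
  innerSL ℝ (hg.toLp g)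

theorem integralFunctional_apply {g : ℝ → ℝ} (hg : MemLp g 2 vol) (f : L2) :
    integralFunctional hg f = ∫ x in (-1 : ℝ)..1, g x * f x := by
  rw [← inner_toLp hg (Lp.memLp f), Lp.toLp_coeFn]
  rfl

theorem integralFunctional_toLp {f g : ℝ → ℝ} (hg : MemLp g 2 vol) (hf : MemLp f 2 vol) :
    integralFunctional hg (hf.toLp f) = ∫ x in (-1 : ℝ)..1, g x * f x :=
  inner_toLp hg hf

theorem norm_integralFunctional {g : ℝ → ℝ} (hg : MemLp g 2 vol) :
    ‖integralFunctional hg‖ = nrm g := by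
  rw [integralFunctional, innerSL_apply_norm, norm_toLp]

/-- The error at f is |∫ w f^(r)|. Cauchy–Schwarz bounds it by ‖w‖, and an r-fold primitive of w /
‖w‖ attains the bound when w is not null. -/
theorem approxError_integralFunctional {r k : ℕ} (hk : k < r) {w : ℝ → ℝ} (hw : ACUpTo r w)
    (hc : ContinuousOn w II) (hL : MemLp (D r w) 2 vol) (hb : BoundaryCond r k w) :
    approxError r k (integralFunctional hL) = norm2 w := by
  have hwL := memLp_of_continuousOn hc
  have key : ∀ f (hf : MemSob r f),
      |D k f (-1) - integralFunctional hL (hf.memLp_self.toLp f)| =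
        |∫ x in (-1 : ℝ)..1, w x * D r f x| := by
    intro f hf
    rw [integralFunctional_toLp, integral_D_mul_of_boundaryCond hk hw hf.acUpTo hb]
    rw [sub_add_cancel_left, abs_neg, abs_mul, abs_pow, abs_neg, abs_one, one_pow, one_mul]
  rw [norm2_eq hwL]
  apply le_antisymm
  · refine iSup₂_le fun f hf => ?_
    rw [Real.enorm_eq_ofReal_abs, key f hf.memSob]
    refine ENNReal.ofReal_le_ofReal ((abs_integral_mul_le hwL hf.memSob.memLp).trans ?_)
    exact mul_le_of_le_one_right (nrm_nonneg w) hf.nrm_le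
  · rcases (nrm_nonneg w).eq_or_lt with h0 | h0
    · rw [← h0]; simp
    obtain ⟨f, hf, hfw⟩ := exists_memSob_D_eq (show 1 ≤ r by omega) hc
    have hfD : nrm (D r f) = nrm w := nrm_congr fun x hx => hfw ⟨hx.1.le, hx.2.le⟩
    have hW : MemW r (fun x => (nrm w)⁻¹ * f x) := by
      refine memW_of_nrm_le (hf.const_mul _) ?_
      rw [D_const_mul, nrm_const_mul, hfD, abs_of_pos (inv_pos.2 h0), inv_mul_cancel₀ h0.ne']
    refine le_trans ?_ (hW.enorm_sub_le k _)
    rw [Real.enorm_eq_ofReal_abs, apply_toLp_const_mul _ hf, D_const_mul, ← mul_sub, abs_mul,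
      key f hf, abs_of_pos (inv_pos.2 h0)]
    refine ENNReal.ofReal_le_ofReal (le_of_eq ?_)
    have : ∫ x in (-1 : ℝ)..1, w x * D r f x = nrm w ^ 2 := by
      rw [nrm_sq]
      exact integral_congr_of_Ioo fun x hx => by rw [hfw ⟨hx.1.le, hx.2.le⟩, pow_two]
    rw [this, abs_of_nonneg (sq_nonneg _)]
    field_simp

theorem MemSob.D {m n : ℕ} (hn : 1 ≤ n) {f : ℝ → ℝ} (hf : MemSob (n + m) f) :
    MemSob n (D m f) where
  contDiffOn := contDiffOn_D (by
    rw [show n - 1 + m = n + m - 1 by omega]; exact hf.contDiffOn)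
  absCont := by
    rw [D_D, show n - 1 + m = n + m - 1 by omega]; exact hf.absCont
  memLp := by rw [D_D]; exact hf.memLp

theorem eqOn_taylorWithinEval {r : ℕ} (hr : 1 ≤ r) {f : ℝ → ℝ}
    (hf : ContDiffOn ℝ (r : ℕ∞) f II) (h0 : EqOn (D r f) 0 II) :
    EqOn f (taylorWithinEval f (r - 1) II (-1)) II := by
  obtain ⟨n, rfl⟩ : ∃ n, r = n + 1 := ⟨r - 1, by omega⟩
  intro x hx
  have h := taylor_mean_remainder_bound (f := f) (C := 0) (n := n) (by norm_num)
    (by simpa using hf) hx (fun y hy => by rw [norm_le_zero_iff]; exact h0 hy)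
  rw [zero_mul, zero_div, norm_le_zero_iff, sub_eq_zero] at h
  exact h

theorem exists_polynomial_eqOn {r : ℕ} (hr : 1 ≤ r) {f : ℝ → ℝ}
    (hf : ContDiffOn ℝ (r : ℕ∞) f II) (h0 : EqOn (D r f) 0 II) :
    ∃ Q ∈ Polynomial.degreeLT ℝ r, EqOn f (fun x => Q.eval x) II := by
  refine ⟨∑ j ∈ Finset.range r, Polynomial.C (((j.factorial : ℝ))⁻¹ * D j f (-1)) *
    (Polynomial.X + Polynomial.C 1) ^ j, ?_, fun x hx => ?_⟩
  · refine Submodule.sum_mem _ fun j hj => ?_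
    rw [Finset.mem_range] at hj
    rw [Polynomial.mem_degreeLT]
    refine lt_of_le_of_lt ?_ (Nat.cast_lt.2 hj)
    compute_degree
    exact le_rfl
  · rw [eqOn_taylorWithinEval hr hf h0 hx, taylor_within_apply, Nat.sub_add_cancel hr]
    simp only [Polynomial.eval_finsetSum, Polynomial.eval_mul, Polynomial.eval_C,
      Polynomial.eval_pow, Polynomial.eval_add, Polynomial.eval_X, smul_eq_mul]
    refine Finset.sum_congr rfl fun j _ => ?_
    rw [sub_neg_eq_add]
    ring

/-! ### Energy identities, optimality and uniqueness for the boundary value problem -/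

section Solution

/-- `u ∈ L₂^{2r}` solves `(-1)^r u^(2r) + μ u = 0` on `(-1, 1)`. -/
structure SolvesEqn (r : ℕ) (μ : ℝ) (u : ℝ → ℝ) : Prop where
  memSob : MemSob (2 * r) u
  eqn : ∀ x ∈ Ioo (-1 : ℝ) 1, (-1) ^ r * D (2 * r) u x + μ * u x = 0

variable {r k : ℕ} {μ : ℝ} {u : ℝ → ℝ}

theorem IsSolution.solvesEqn (hu : IsSolution r k μ u) : SolvesEqn r μ u := ⟨hu.memSob, hu.eqn⟩

theorem IsSolution.boundaryCond (hu : IsSolution r k μ u) : BoundaryCond r k u :=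
  ⟨hu.left, hu.right⟩

theorem SolvesEqn.memSob_D (hr : 1 ≤ r) (hu : SolvesEqn r μ u) : MemSob r (D r u) :=
  MemSob.D (by omega) (by rw [← two_mul]; exact hu.memSob)

theorem SolvesEqn.continuousOn (hr : 1 ≤ r) (hu : SolvesEqn r μ u) : ContinuousOn u II := by
  have := hu.memSob.continuousOn_D (j := 0) (by omega)
  rwa [D_zero] at this

theorem SolvesEqn.D_D_eq (hu : SolvesEqn r μ u) {x : ℝ} (hx : x ∈ Ioo (-1 : ℝ) 1) :
    D r (D r u) x = -(-1) ^ r * μ * u x := by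
  have h := hu.eqn x hx
  rw [D_D, ← two_mul]
  have h1 : (-1 : ℝ) ^ r * (-1) ^ r = 1 := by rw [← mul_pow]; norm_num
  linear_combination (-1) ^ r * h - D (2 * r) u x * h1

theorem SolvesEqn.integral_mul_D_D (hu : SolvesEqn r μ u) (w : ℝ → ℝ) :
    (-1) ^ r * ∫ x in (-1 : ℝ)..1, w x * D r (D r u) x =
      -(μ * ∫ x in (-1 : ℝ)..1, w x * u x) := by
  have h1 : (-1 : ℝ) ^ r * (-1) ^ r = 1 := by rw [← mul_pow]; norm_num
  rw [← intervalIntegral.integral_const_mul, ← intervalIntegral.integral_const_mul,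
    ← intervalIntegral.integral_neg]
  refine integral_congr_of_Ioo fun x hx => ?_
  rw [hu.D_D_eq hx]
  linear_combination -(w x * μ * u x) * h1

theorem SolvesEqn.nrm_D_D (hμ : 0 ≤ μ) (hu : SolvesEqn r μ u) :
    nrm (D r (D r u)) = μ * nrm u := by
  rw [nrm_congr fun x hx => hu.D_D_eq hx, nrm_const_mul, abs_mul, abs_neg, abs_pow, abs_neg,
    abs_one, one_pow, one_mul, abs_of_nonneg hμ]

theorem IsSolution.integral_D_mul_D (hk : k < r) (hu : IsSolution r k μ u) {w : ℝ → ℝ}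
    (hw : ACUpTo r w) (hb : BoundaryCond r k w) :
    ∫ x in (-1 : ℝ)..1, D r w x * D r u x =
      D k (D r u) (-1) - μ * ∫ x in (-1 : ℝ)..1, w x * u x := by
  rw [integral_D_mul_of_boundaryCond hk hw (hu.solvesEqn.memSob_D (by omega)).acUpTo hb, hu.solvesEqn.integral_mul_D_D]
  ring

/-- The preceding identity with w = u. -/
theorem IsSolution.D_D_left (hk : k < r) (hu : IsSolution r k μ u) :
    D k (D r u) (-1) = nrm (D r u) ^ 2 + μ * nrm u ^ 2 := by
  have := hu.integral_D_mul_D hk (hu.memSob.acUpTo.mono (by omega)) hu.boundaryCond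
  rw [nrm_sq, nrm_sq]
  simp only [pow_two]
  linarith

theorem IsSolution.nrm_le_approxError (hk : k < r) (hμ : 0 ≤ μ) (hu : IsSolution r k μ u)
    {S : L2 →L[ℝ] ℝ} (hS : ‖S‖ ≤ nrm (D r u)) : norm2 u ≤ approxError r k S := by
  have hs := hu.solvesEqn.memSob_D (by omega)
  have hfL := hs.memLp_self
  rcases hμ.eq_or_lt with rfl | hμ
  · by_cases htop : approxError r k S = ⊤
    · rw [htop]; exact le_top
    have h0 := hu.solvesEqn.nrm_D_D le_rfl
    rw [zero_mul] at h0
    have hex := exact_of_approxError_ne_top htop hs h0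
    rw [hu.D_D_left hk, zero_mul, add_zero] at hex
    have hSeq : S = integralFunctional hfL := by
      set v : L2 := (InnerProductSpace.toDual ℝ L2).symm S with hv
      have hvn : ‖v‖ ≤ nrm (D r u) := by rw [hv, LinearIsometryEquiv.norm_map]; exact hS
      have hvi : ∀ g, inner ℝ v g = S g := fun g => InnerProductSpace.toDual_symm_apply
      -- With g = u^(r) and S g = ‖g‖², expanding the square gives ‖v‖² - ‖g‖² ≤ 0: the Riesz
      -- representer of S is g.
      have hz : ‖v - hfL.toLp _‖ ^ 2 ≤ 0 := by
        rw [norm_sub_sq_real, hvi, ← hex, norm_toLp]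
        nlinarith [norm_nonneg v]
      have hveq : v = hfL.toLp _ := by
        rw [← sub_eq_zero, ← norm_eq_zero]
        exact pow_eq_zero_iff two_ne_zero |>.1 (le_antisymm hz (sq_nonneg _))
      ext g
      rw [← hvi, hveq]
      rfl
    rw [hSeq, approxError_integralFunctional hk (hu.memSob.acUpTo.mono (by omega))
      (hu.solvesEqn.continuousOn (by omega)) hfL hu.boundaryCond]
  · rw [norm2_eq (memLp_of_continuousOn (hu.solvesEqn.continuousOn (by omega)))]
    rcases (nrm_nonneg u).eq_or_lt with h0 | h0
    · rw [← h0]; simp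
    have hc : 0 < (μ * nrm u)⁻¹ := by positivity
    -- The equation gives ‖(u^(r))^(r)‖ = μ ‖u‖, so this multiple of u^(r) has r-th derivative of
    -- norm 1.
    have hW : MemW r (fun x => (μ * nrm u)⁻¹ * D r u x) := by
      refine memW_of_nrm_le (hs.const_mul _) ?_
      rw [D_const_mul, nrm_const_mul, hu.solvesEqn.nrm_D_D hμ.le, abs_of_pos hc,
        inv_mul_cancel₀ (by positivity)]
    refine le_trans ?_ (hW.enorm_sub_le k _)
    rw [Real.enorm_eq_ofReal_abs, apply_toLp_const_mul _ hs, D_const_mul, ← mul_sub]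
    refine ENNReal.ofReal_le_ofReal (le_trans ?_ (le_abs_self _))
    have h1 : S (hfL.toLp _) ≤ nrm (D r u) ^ 2 := by
      refine (le_abs_self _).trans ((S.le_opNorm _).trans ?_)
      rw [norm_toLp, pow_two]
      exact mul_le_mul_of_nonneg_right hS (nrm_nonneg _)
    rw [hu.D_D_left hk]
    calc nrm u = (μ * nrm u)⁻¹ * (μ * nrm u ^ 2) := by field_simp
      _ ≤ _ := mul_le_mul_of_nonneg_left (by linarith) hc.le

/-- The difference w = u - v has zero boundary data, so ‖w^(r)‖² = -μ ‖w‖² ≤ 0. Then w is its Taylor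
polynomial of degree below r at -1, which vanishes. -/
theorem SolvesEqn.eqOn (hr : 1 ≤ r) (hμ : 0 ≤ μ) {v : ℝ → ℝ} (hu : SolvesEqn r μ u)
    (hv : SolvesEqn r μ v) (hL : ∀ s < r, D s u (-1) = D s v (-1))
    (hR : ∀ s < r, D s u 1 = D s v 1) : EqOn u v II := by
  have hcd : ∀ {w : ℝ → ℝ}, SolvesEqn r μ w → ∀ {j : ℕ}, j < 2 * r → ∀ {x}, x ∈ II →
      ContDiffWithinAt ℝ j w II x := fun hw j hj x hx =>
    (hw.memSob.contDiffOn.of_le (by norm_cast; omega)) x hx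
  have hD : ∀ j < 2 * r, EqOn (D j (u - v)) (D j u - D j v) II := fun j hj x hx =>
    iteratedDerivWithin_sub hx uniqueDiffOn_II (hcd hu hj hx) (hcd hv hj hx)
  have hw : ContDiffOn ℝ (r : ℕ∞) (u - v) II :=
    ((hu.memSob.contDiffOn.sub hv.memSob.contDiffOn).of_le (by norm_cast; omega))
  have hwS := memSob_of_contDiffOn (by omega) hw
  have hl : ∀ s < r, D s (u - v) (-1) = 0 := fun s hs => by
    rw [hD s (by omega) left_mem_II, Pi.sub_apply, hL s hs, sub_self]
  have hr' : ∀ s < r, D s (u - v) 1 = 0 := fun s hs => by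
    rw [hD s (by omega) right_mem_II, Pi.sub_apply, hR s hs, sub_self]
  -- Pairing with u and v separately avoids splitting the derivative of order 2r of u - v; only
  -- lower orders are continuous by hypothesis.
  have hi : ∀ {f : ℝ → ℝ}, SolvesEqn r μ f →
      ∫ x in (-1 : ℝ)..1, D r (u - v) x * D r f x =
        -(μ * ∫ x in (-1 : ℝ)..1, (u - v) x * f x) := fun hf => by
    rw [integral_D_mul_of_boundary_eq_zero hwS.acUpTo (hf.memSob_D hr).acUpTo hl hr',
      hf.integral_mul_D_D]
  have hcw : ContinuousOn (u - v) II := hw.continuousOn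
  have hcD : ContinuousOn (D r (u - v)) II :=
    (contDiffOn_D (m := 0) (by rw [zero_add]; exact hw)).continuousOn
  have hint : ∀ {f g : ℝ → ℝ}, ContinuousOn f II → ContinuousOn g II →
      IntervalIntegrable (fun x => f x * g x) volume (-1) 1 := fun hf hg =>
    ContinuousOn.intervalIntegrable (by rw [uIcc_of_le (by norm_num)]; exact hf.mul hg)
  have hsq : nrm (D r (u - v)) ^ 2 = -(μ * nrm (u - v) ^ 2) := by
    have e1 : nrm (D r (u - v)) ^ 2 = (∫ x in (-1 : ℝ)..1, D r (u - v) x * D r u x) -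
        ∫ x in (-1 : ℝ)..1, D r (u - v) x * D r v x := by
      rw [← intervalIntegral.integral_sub
        (hint hcD (hu.memSob.continuousOn_D (by omega)))
        (hint hcD (hv.memSob.continuousOn_D (by omega))), nrm_sq]
      refine integral_congr_of_Ioo fun x hx => ?_
      rw [← mul_sub, pow_two]
      congr 1
      exact hD r (by omega) ⟨hx.1.le, hx.2.le⟩
    have e2 : nrm (u - v) ^ 2 = (∫ x in (-1 : ℝ)..1, (u - v) x * u x) -
        ∫ x in (-1 : ℝ)..1, (u - v) x * v x := by
      rw [← intervalIntegral.integral_sub (hint hcw (hu.continuousOn hr))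
        (hint hcw (hv.continuousOn hr)), nrm_sq]
      refine integral_congr_of_Ioo fun x hx => ?_
      rw [← mul_sub, pow_two, Pi.sub_apply]
    rw [e1, e2, hi hu, hi hv]
    ring
  have h0 : nrm (D r (u - v)) = 0 := by
    have := mul_nonneg hμ (sq_nonneg (nrm (u - v)))
    exact pow_eq_zero_iff two_ne_zero |>.1 (le_antisymm (by linarith) (sq_nonneg _))
  have hT := eqOn_taylorWithinEval (by omega) hw (eqOn_zero_of_nrm_eq_zero hcD h0)
  intro x hx
  have h := hT hx
  rw [taylor_within_apply, Finset.sum_eq_zero] at h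
  · exact sub_eq_zero.1 h
  · intro j hj
    rw [Finset.mem_range] at hj
    rw [show iteratedDerivWithin j (u - v) II (-1) = 0 from hl j (by omega), smul_zero]

theorem IsSolution.eqOn (hk : k < r) (hμ : 0 ≤ μ) {v : ℝ → ℝ} (hu : IsSolution r k μ u)
    (hv : IsSolution r k μ v) : EqOn u v II :=
  hu.solvesEqn.eqOn (by omega) hμ hv.solvesEqn (fun s hs => by rw [hu.left s hs, hv.left s hs])
    fun s hs => by rw [hu.right s hs, hv.right s hs]

end Solution

end StechkinInterval

/-! ### Solutions of y^(n) = ν y by the exponential of the companion map -/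

namespace StechkinInterval

theorem continuous_exp_clm (n : ℕ) :
    Continuous (NormedSpace.exp : ((Fin n → ℝ) →L[ℝ] (Fin n → ℝ)) → _) :=
  letI := NormedAlgebra.restrictScalars ℚ ℝ ((Fin n → ℝ) →L[ℝ] (Fin n → ℝ))
  NormedSpace.exp_continuous

section Flow

variable {n : ℕ} [NeZero n]

/-- The linear map `c ↦ (c₁, …, c_{n-1}, 0)`. -/
noncomputable def shiftMap (n : ℕ) : (Fin n → ℝ) →L[ℝ] (Fin n → ℝ) :=
  ContinuousLinearMap.pi fun i =>
    if h : i.1 + 1 < n then ContinuousLinearMap.proj ⟨i.1 + 1, h⟩ else 0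

/-- The linear map `c ↦ (0, …, 0, c₀)`. -/
noncomputable def lastMap (n : ℕ) [NeZero n] : (Fin n → ℝ) →L[ℝ] (Fin n → ℝ) :=
  ContinuousLinearMap.pi fun i => if i.1 + 1 < n then 0 else ContinuousLinearMap.proj 0

/-- The companion map of the equation `y^(n) = ν y`. -/
noncomputable def companionMap (n : ℕ) [NeZero n] (ν : ℝ) : (Fin n → ℝ) →L[ℝ] (Fin n → ℝ) :=
  shiftMap n + ν • lastMap n

/-- The vector `(y, y', …, y^(n-1))` at `x` of the solution of `y^(n) = ν y` that takes the value
`c` at `-1`. -/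
noncomputable def state (ν : ℝ) (c : Fin n → ℝ) (x : ℝ) : Fin n → ℝ :=
  NormedSpace.exp ((x + 1) • companionMap n ν) c

theorem state_left (ν : ℝ) (c : Fin n → ℝ) : state ν c (-1) = c := by
  simp [state]

theorem hasDerivAt_state (ν : ℝ) (c : Fin n → ℝ) (x : ℝ) :
    HasDerivAt (state ν c) (companionMap n ν (state ν c x)) x := by
  have h := (hasDerivAt_exp_smul_const' (𝕂 := ℝ) (companionMap n ν) (x + 1)).comp_add_const x 1
  exact (ContinuousLinearMap.apply ℝ (Fin n → ℝ) c).hasFDerivAt.comp_hasDerivAt x h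

theorem continuous_state : Continuous fun p : ℝ × (Fin n → ℝ) × ℝ => state p.1 p.2.1 p.2.2 := by
  have h : Continuous fun p : ℝ × (Fin n → ℝ) × ℝ =>
      NormedSpace.exp ((p.2.2 + 1) • companionMap n p.1) := by
    refine (continuous_exp_clm _).comp ?_
    unfold companionMap
    fun_prop
  exact h.clm_apply (by fun_prop)

/-- The derivatives of the solution of `y^(n) = ν y` that takes the value `c` at `-1`. -/
noncomputable def stateDeriv (ν : ℝ) (c : Fin n → ℝ) (j : ℕ) (x : ℝ) : ℝ :=
  if h : j < n then state ν c x ⟨j, h⟩ else ν * state ν c x 0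

theorem hasDerivAt_stateDeriv (ν : ℝ) (c : Fin n → ℝ) {j : ℕ} (hj : j < n) (x : ℝ) :
    HasDerivAt (stateDeriv ν c j) (stateDeriv ν c (j + 1) x) x := by
  have h := hasDerivAt_pi.1 (hasDerivAt_state ν c x) ⟨j, hj⟩
  have e : stateDeriv ν c j = fun x => state ν c x ⟨j, hj⟩ := by
    ext x; rw [stateDeriv, dif_pos hj]
  have e' : stateDeriv ν c (j + 1) x = companionMap n ν (state ν c x) ⟨j, hj⟩ := by
    by_cases hj' : j + 1 < n <;> simp [stateDeriv, companionMap, shiftMap, lastMap, hj']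
  rw [e, e']
  exact h

/-- The solution of `y^(n) = ν y` that takes the initial values `c` at `-1`. -/
noncomputable def flow (ν : ℝ) (c : Fin n → ℝ) (x : ℝ) : ℝ := state ν c x 0

theorem stateDeriv_zero (ν : ℝ) (c : Fin n → ℝ) : stateDeriv ν c 0 = flow ν c := by
  ext x
  rw [stateDeriv, dif_pos (NeZero.pos n)]
  rfl

theorem D_flow (ν : ℝ) (c : Fin n → ℝ) {j : ℕ} (hj : j ≤ n) :
    EqOn (D j (flow ν c)) (stateDeriv ν c j) II := by
  rw [← stateDeriv_zero]
  exact D_eqOn_of_hasDerivWithinAt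
    (fun i hi x _ => (hasDerivAt_stateDeriv ν c hi x).hasDerivWithinAt) hj

theorem D_flow_of_lt (ν : ℝ) (c : Fin n → ℝ) {j : ℕ} (hj : j < n) {x : ℝ} (hx : x ∈ II) :
    D j (flow ν c) x = state ν c x ⟨j, hj⟩ := by
  rw [D_flow ν c hj.le hx, stateDeriv, dif_pos hj]

theorem D_flow_self (ν : ℝ) (c : Fin n → ℝ) {x : ℝ} (hx : x ∈ II) :
    D n (flow ν c) x = ν * flow ν c x := by
  rw [D_flow ν c le_rfl hx, stateDeriv, dif_neg (lt_irrefl n), flow]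

theorem contDiffOn_flow (ν : ℝ) (c : Fin n → ℝ) : ContDiffOn ℝ (n : ℕ∞) (flow ν c) II := by
  rw [← stateDeriv_zero]
  refine contDiffOn_of_hasDerivWithinAt
    (fun i hi x _ => (hasDerivAt_stateDeriv ν c hi x).hasDerivWithinAt) ?_
  have : stateDeriv ν c n = fun x => ν * state ν c x 0 := by
    ext x; rw [stateDeriv, dif_neg (lt_irrefl n)]
  rw [this]
  exact fun x _ => (continuousAt_const.mul
    (hasDerivAt_pi.1 (hasDerivAt_state ν c x) 0).continuousAt).continuousWithinAt

end Flow

/-! ### Existence of u_μ and continuity in μ -/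

section BoundaryProblem

variable {r k : ℕ} [NeZero (2 * r)]

/-- The number `ν` for which the equation `(-1)^r u^(2r) + μ u = 0` reads `u^(2r) = ν u`. -/
def eqnCoeff (r : ℕ) (μ : ℝ) : ℝ := -(-1) ^ r * μ

theorem solvesEqn_flow (μ : ℝ) (c : Fin (2 * r) → ℝ) : SolvesEqn r μ (flow (eqnCoeff r μ) c) where
  memSob := memSob_of_contDiffOn NeZero.one_le (contDiffOn_flow _ c)
  eqn x hx := by
    rw [D_flow_self _ c ⟨hx.1.le, hx.2.le⟩, eqnCoeff]
    have h1 : (-1 : ℝ) ^ r * (-1) ^ r = 1 := by rw [← mul_pow]; norm_num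
    linear_combination -(μ * flow (-(-1) ^ r * μ) c x) * h1

/-- The projection of `ℝ^{2r}` on the first `r` coordinates. -/
noncomputable def headMap (r : ℕ) : (Fin (2 * r) → ℝ) →L[ℝ] (Fin (2 * r) → ℝ) :=
  ContinuousLinearMap.pi fun i => if i.1 < r then ContinuousLinearMap.proj i else 0

/-- The map of `ℝ^{2r}` that moves the first `r` coordinates to the last `r` places. -/
noncomputable def tailMap (r : ℕ) : (Fin (2 * r) → ℝ) →L[ℝ] (Fin (2 * r) → ℝ) :=
  ContinuousLinearMap.pi fun i =>
    if i.1 < r then 0 else ContinuousLinearMap.proj ⟨i.1 - r, by omega⟩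

/-- The boundary values at `-1` and at `1` of the solution with given initial values at `-1`. -/
noncomputable def boundaryMap (r : ℕ) [NeZero (2 * r)] (ν : ℝ) :
    (Fin (2 * r) → ℝ) →L[ℝ] (Fin (2 * r) → ℝ) :=
  headMap r + tailMap r * NormedSpace.exp ((1 + 1 : ℝ) • companionMap (2 * r) ν)

theorem continuous_boundaryMap : Continuous (boundaryMap r) := by
  refine continuous_const.add (continuous_const.mul ((continuous_exp_clm _).comp ?_))
  unfold companionMap
  fun_prop

theorem boundaryMap_apply (ν : ℝ) (c : Fin (2 * r) → ℝ) (i : Fin (2 * r)) :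
    boundaryMap r ν c i =
      if i.1 < r then c i else state ν c 1 ⟨i.1 - r, by omega⟩ := by
  by_cases h : i.1 < r <;> simp [boundaryMap, headMap, tailMap, state, h]

theorem D_flow_left (ν : ℝ) (c : Fin (2 * r) → ℝ) {s : ℕ} (hs : s < r) :
    D s (flow ν c) (-1) = boundaryMap r ν c ⟨s, by omega⟩ := by
  rw [boundaryMap_apply, if_pos hs, D_flow_of_lt ν c (by omega) left_mem_II, state_left]

theorem D_flow_right (ν : ℝ) (c : Fin (2 * r) → ℝ) {s : ℕ} (hs : s < r) :
    D s (flow ν c) 1 = boundaryMap r ν c ⟨s + r, by omega⟩ := by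
  rw [boundaryMap_apply, if_neg (by simp), D_flow_of_lt ν c (by omega) right_mem_II]
  simp

/-- Uniqueness for the boundary value problem is injectivity of this map on a finite-dimensional
space, hence invertibility; existence of u_μ follows. -/
theorem isUnit_boundaryMap {μ : ℝ} (hμ : 0 ≤ μ) : IsUnit (boundaryMap r (eqnCoeff r μ)) := by
  rw [ContinuousLinearMap.isUnit_iff_isUnit_toLinearMap, Module.End.isUnit_iff]
  have hinj : Function.Injective (boundaryMap r (eqnCoeff r μ)) := by
    intro c c' h
    have hr : 1 ≤ r := by have := NeZero.pos (2 * r); omega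
    have he := (solvesEqn_flow μ c).eqOn hr hμ (solvesEqn_flow μ c')
      (fun s hs => by rw [D_flow_left _ _ hs, D_flow_left _ _ hs, h])
      (fun s hs => by rw [D_flow_right _ _ hs, D_flow_right _ _ hs, h])
    ext i
    have h1 := D_flow_of_lt (eqnCoeff r μ) c i.2 left_mem_II
    have h2 := D_flow_of_lt (eqnCoeff r μ) c' i.2 left_mem_II
    rw [state_left] at h1 h2
    change _ = c i at h1
    change _ = c' i at h2
    rw [← h1, ← h2]
    exact iteratedDerivWithin_congr he left_mem_II
  exact ⟨hinj, LinearMap.injective_iff_surjective.1 hinj⟩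

/-- The boundary values prescribed for `u_μ`. -/
noncomputable def boundaryData (r k : ℕ) (i : Fin (2 * r)) : ℝ :=
  if r - k - 1 = i.1 then (-1 : ℝ) ^ ((k : ℤ) - 1) else 0

/-- The initial values at `-1` of `u_μ`. -/
noncomputable def initialData (r k : ℕ) [NeZero (2 * r)] (μ : ℝ) : Fin (2 * r) → ℝ :=
  Ring.inverse (boundaryMap r (eqnCoeff r μ)) (boundaryData r k)

/-- The function `u_μ`. -/
noncomputable def extremal (r k : ℕ) [NeZero (2 * r)] (μ : ℝ) : ℝ → ℝ :=
  flow (eqnCoeff r μ) (initialData r k μ)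

theorem isSolution_extremal (hk : k < r) {μ : ℝ} (hμ : 0 ≤ μ) :
    IsSolution r k μ (extremal r k μ) := by
  have hb : boundaryMap r (eqnCoeff r μ) (initialData r k μ) = boundaryData r k := by
    rw [initialData, ← mul_apply_eq_comp,
      Ring.mul_inverse_cancel _ (isUnit_boundaryMap hμ), one_apply_eq_self]
  have h := solvesEqn_flow μ (initialData r k μ)
  refine ⟨h.memSob, h.eqn, fun s hs => ?_, fun s hs => ?_⟩
  · rw [extremal, D_flow_left _ _ hs, hb, boundaryData]
  · rw [extremal, D_flow_right _ _ hs, hb, boundaryData, if_neg]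
    simp only
    omega

/-- Inversion is continuous at units, and the boundary map is known to be one only for μ ≥ 0.
Composing with |t| gives a continuous function on all of ℝ, ready for the intermediate value
theorem. -/
theorem continuous_initialData_abs : Continuous fun t : ℝ => initialData r k |t| := by
  refine Continuous.clm_apply (continuous_iff_continuousAt.2 fun t => ?_) continuous_const
  obtain ⟨U, hU⟩ := isUnit_boundaryMap (r := r) (abs_nonneg t)
  have h := NormedRing.inverse_continuousAt U
  rw [hU] at h
  refine ContinuousAt.comp (f := fun t : ℝ => boundaryMap r (eqnCoeff r |t|)) h ?_
  refine (continuous_boundaryMap.comp ?_).continuousAt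
  unfold eqnCoeff
  fun_prop

theorem continuous_nrm_D_extremal_abs (hr : 1 ≤ r) :
    Continuous fun t : ℝ => nrm (D r (extremal r k |t|)) := by
  have h : Continuous fun p : ℝ × ℝ =>
      state (eqnCoeff r |p.1|) (initialData r k |p.1|) p.2 ⟨r, by omega⟩ ^ 2 := by
    have h1 : Continuous fun p : ℝ × ℝ => (eqnCoeff r |p.1|, initialData r k |p.1|, p.2) := by
      refine Continuous.prodMk ?_ (Continuous.prodMk ?_ continuous_snd)
      · unfold eqnCoeff; fun_prop
      · exact continuous_initialData_abs.comp continuous_fst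
    exact ((continuous_apply _).comp (continuous_state.comp h1)).pow 2
  have e : (fun t : ℝ => nrm (D r (extremal r k |t|))) = fun t => √(∫ x in (-1 : ℝ)..1,
      state (eqnCoeff r |t|) (initialData r k |t|) x ⟨r, by omega⟩ ^ 2) := by
    ext t
    rw [nrm]
    congr 1
    refine integral_congr_of_Ioo fun x hx => ?_
    rw [extremal, D_flow_of_lt _ _ (by omega) ⟨hx.1.le, hx.2.le⟩]
  rw [e]
  exact Real.continuous_sqrt.comp
    (intervalIntegral.continuous_parametric_intervalIntegral_of_continuous' h (-1) 1)

/-- The function `u_0^(r)` is a polynomial, whose norm is at most `M_{-1}`. -/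
theorem nrm_D_extremal_zero_le (hk : k < r) :
    ENNReal.ofReal (nrm (D r (extremal r k 0))) ≤ markovConst r k := by
  have hu := isSolution_extremal (r := r) (k := k) hk le_rfl
  have hc : ContDiffOn ℝ ((r + r : ℕ) : ℕ∞) (extremal r k 0) II := by
    rw [← two_mul]; exact contDiffOn_flow _ _
  obtain ⟨Q, hQ, hPQ⟩ := exists_polynomial_eqOn (f := D r (extremal r k 0)) (r := r) (by omega)
    (contDiffOn_D hc) fun x hx => by
      rw [D_D, ← two_mul, extremal, D_flow_self _ _ hx, eqnCoeff]
      simp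
  have hn : nrm (D r (extremal r k 0)) = nrm fun x => Q.eval x :=
    nrm_congr fun x hx => hPQ ⟨hx.1.le, hx.2.le⟩
  -- At μ = 0 this reads Q^(k)(-1) = ‖Q‖², the hypothesis of `nrm_le_markovConst`.
  have h := hu.D_D_left hk
  rw [zero_mul, add_zero, hn, show D k (D r (extremal r k 0)) (-1) = D k (fun x => Q.eval x) (-1)
    from iteratedDerivWithin_congr hPQ left_mem_II, D_polynomial Q k left_mem_II] at h
  rw [hn]
  exact nrm_le_markovConst hQ h

end BoundaryProblem

end StechkinInterval

/-! ### Unboundedness of ‖u_μ^(r)‖ and the choice of μ for a given N -/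

namespace StechkinInterval

/-- Functions with prescribed derivatives at `-1` that vanish near `1` and have a small norm. -/
theorem exists_localized (j : ℕ) {ε : ℝ} (hε : 0 < ε) :
    ∃ w : ℝ → ℝ, (∀ n : ℕ, ContDiffOn ℝ (n : ℕ∞) w II) ∧
      (∀ s, D s w (-1) = if j = s then 1 else 0) ∧ (∀ s, D s w 1 = 0) ∧ nrm w ≤ ε := by
  -- The function below is bounded by 2^j and supported in length h, so its squared norm is at most
  -- (2^j)² h.
  obtain ⟨h, h0, h1, hh⟩ : ∃ h : ℝ, 0 < h ∧ h ≤ 1 ∧ (2 ^ j) ^ 2 * h ≤ ε ^ 2 := by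
    refine ⟨min 1 (ε ^ 2 / (2 ^ j) ^ 2), by positivity, min_le_left _ _, ?_⟩
    calc (2 ^ j) ^ 2 * min 1 (ε ^ 2 / (2 ^ j) ^ 2)
        ≤ (2 ^ j) ^ 2 * (ε ^ 2 / (2 ^ j) ^ 2) := by gcongr; exact min_le_right _ _
      _ = ε ^ 2 := by field_simp
  let ψ : ContDiffBump (-1 : ℝ) := ⟨h / 2, h, by positivity, by linarith⟩
  -- (x + 1)^j / j! carries the prescribed derivatives at -1, and the bump equals 1 near -1, so the
  -- product keeps them.
  let Q : Polynomial ℝ :=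
    Polynomial.C ((j.factorial : ℝ)⁻¹) * (Polynomial.X + Polynomial.C 1) ^ j
  let w : ℝ → ℝ := fun x => Q.eval x * ψ x
  have hQc : ∀ n : ℕ, ContDiff ℝ (n : ℕ∞) fun x => Q.eval x := fun n => by
    simpa [Polynomial.aeval_def, Polynomial.eval₂_id] using
      Polynomial.contDiff_aeval (𝕜 := ℝ) Q (n : ℕ∞)
  have hw : ∀ n : ℕ, ContDiff ℝ (n : ℕ∞) w := fun n => (hQc n).mul ψ.contDiff
  have hz : ∀ x, h ≤ x + 1 → w x = 0 := fun x hx => by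
    have : ψ x = 0 := ψ.zero_of_le_dist (by
      rw [Real.dist_eq, sub_neg_eq_add, abs_of_nonneg (by linarith)]; exact hx)
    simp only [w, this, mul_zero]
  refine ⟨w, fun n => (hw n).contDiffOn, fun s => ?_, fun s => ?_, ?_⟩
  · have e1 : D s w (-1) = D s (fun x => Q.eval x) (-1) := by
      rw [D, D, iteratedDerivWithin_eq_iteratedDeriv uniqueDiffOn_II
        (by exact_mod_cast (hw s).contDiffAt) left_mem_II,
        iteratedDerivWithin_eq_iteratedDeriv uniqueDiffOn_II
        (by exact_mod_cast (hQc s).contDiffAt) left_mem_II]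
      refine Filter.EventuallyEq.iteratedDeriv_eq s ?_
      filter_upwards [ψ.eventuallyEq_one] with x hx
      simp [w, hx]
    rw [e1, D_polynomial Q s left_mem_II]
    simp only [Q, Polynomial.iterate_derivative_C_mul, Polynomial.iterate_derivative_X_add_pow]
    rcases lt_trichotomy j s with hs | rfl | hs
    · simp [Nat.descFactorial_eq_zero_iff_lt.2 hs, hs.ne]
    · simp [Nat.descFactorial_self, Nat.factorial_ne_zero]
    · simp [hs.ne', Nat.sub_ne_zero_of_lt hs]
  · rw [D, iteratedDerivWithin_eq_iteratedDeriv uniqueDiffOn_II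
        (by exact_mod_cast (hw s).contDiffAt) right_mem_II,
      Filter.EventuallyEq.iteratedDeriv_eq (g := fun _ => 0) s]
    · simp
    · filter_upwards [lt_mem_nhds (show (0 : ℝ) < 1 by norm_num)] with x hx
      exact hz x (by linarith)
  · rw [nrm, Real.sqrt_le_left hε.le]
    refine le_trans ?_ hh
    have hi : ∀ a b : ℝ, IntervalIntegrable (fun x => w x ^ 2) volume a b := fun a b =>
      ((hw 0).continuous.pow 2).intervalIntegrable a b
    rw [← intervalIntegral.integral_add_adjacent_intervals (hi (-1) (-1 + h)) (hi (-1 + h) 1)]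
    have z : ∫ x in (-1 + h)..1, w x ^ 2 = 0 := by
      rw [intervalIntegral.integral_congr (g := fun _ => 0), intervalIntegral.integral_zero]
      intro x hx
      rw [uIcc_of_le (by linarith)] at hx
      simp only
      rw [hz x (by linarith [hx.1])]
      norm_num
    rw [z, add_zero]
    refine (le_abs_self _).trans ?_
    have hb := intervalIntegral.norm_integral_le_of_norm_le_const (a := -1) (b := -1 + h)
      (f := fun x => w x ^ 2) (C := (2 ^ j) ^ 2) fun x hx => by
        rw [uIoc_of_le (by linarith)] at hx
        rw [Real.norm_eq_abs, abs_pow]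
        refine pow_le_pow_left₀ (abs_nonneg _) ?_ 2
        have hx0 : 0 ≤ x + 1 := by linarith [hx.1]
        have hQ : Q.eval x = (j.factorial : ℝ)⁻¹ * (x + 1) ^ j := by simp [Q]
        have hj : (j.factorial : ℝ)⁻¹ ≤ 1 :=
          inv_le_one_of_one_le₀ (by exact_mod_cast Nat.one_le_iff_ne_zero.2 j.factorial_ne_zero)
        simp only [w]
        rw [hQ, abs_of_nonneg (mul_nonneg (by positivity) ψ.nonneg)]
        calc (j.factorial : ℝ)⁻¹ * (x + 1) ^ j * ψ x ≤ 1 * 2 ^ j * 1 := by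
              gcongr
              · exact ψ.nonneg
              · linarith [hx.2]
              · exact ψ.le_one
          _ = 2 ^ j := by ring
    rw [Real.norm_eq_abs] at hb
    refine hb.trans_eq ?_
    rw [show -1 + h - -1 = h by ring, abs_of_pos h0]

variable {r k : ℕ} [NeZero (2 * r)]

/-- Suppose ‖u_μ^(r)‖ < N for all μ. A test function f with f^(k)(-1) = 1 and ‖f‖ small against 1/N
then bounds ‖u_μ‖ below by some δ > 0 independent of μ. Comparing u_μ with a fixed w having the same
boundary data and ‖w‖ ≤ δ/2 gives μ (‖u_μ‖² - (δ/2) ‖u_μ‖) ≤ ‖w^(r)‖ N, which fails for large μ. -/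
theorem exists_le_nrm_D_extremal (hk : k < r) {N : ℝ} (hN : 0 < N) :
    ∃ μ, 0 ≤ μ ∧ N ≤ nrm (D r (extremal r k μ)) := by
  by_contra! hlt
  have hr : 1 ≤ r := by omega
  obtain ⟨f, hfc, hfl, -, hfN⟩ := exists_localized k (ε := 1 / (2 * N)) (by positivity)
  have hf := memSob_of_contDiffOn hr (hfc r)
  -- Adding 1 keeps B positive even if f^(r) is null.
  set B := nrm (D r f) + 1
  have hB : 0 < B := by have := nrm_nonneg (D r f); positivity
  have hlow : ∀ μ, 0 ≤ μ → 1 / (2 * B) ≤ nrm (extremal r k μ) := by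
    intro μ hμ
    have hu := isSolution_extremal hk hμ
    set u := extremal r k μ
    have h := integral_D_mul_of_boundaryCond hk (hu.memSob.acUpTo.mono (by omega)) hf.acUpTo
      hu.boundaryCond
    rw [hfl, if_pos rfl] at h
    have h1 := abs_integral_mul_le (hu.solvesEqn.memSob_D hr).memLp_self hf.memLp_self
    have h2 := abs_integral_mul_le (memLp_of_continuousOn (hu.solvesEqn.continuousOn hr)) hf.memLp
    have h3 : nrm (D r u) * nrm f ≤ 1 / 2 := by
      calc nrm (D r u) * nrm f ≤ N * (1 / (2 * N)) := by
            gcongr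
            · exact nrm_nonneg _
            · exact (hlt μ hμ).le
        _ = 1 / 2 := by field_simp
    have h4 : |(-1) ^ r * ∫ x in (-1 : ℝ)..1, u x * D r f x| ≤ nrm u * nrm (D r f) := by
      rwa [abs_mul, abs_pow, abs_neg, abs_one, one_pow, one_mul]
    have h5 : 1 / 2 ≤ nrm u * B := by
      have := neg_abs_le ((-1) ^ r * ∫ x in (-1 : ℝ)..1, u x * D r f x)
      have := le_abs_self (∫ x in (-1 : ℝ)..1, D r u x * f x)
      have := nrm_nonneg u
      have : nrm u * B = nrm u * nrm (D r f) + nrm u := by ring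
      linarith
    rw [div_le_iff₀ (by positivity)]
    linarith
  set δ := 1 / (2 * B)
  have hδ : 0 < δ := by positivity
  obtain ⟨w₀, hc₀, hl₀, hr₀, hN₀⟩ := exists_localized (r - k - 1) (ε := δ / 2) (by positivity)
  set c : ℝ := (-1 : ℝ) ^ ((k : ℤ) - 1)
  have hcabs : |c| = 1 := by rw [abs_zpow]; simp
  set w : ℝ → ℝ := fun x => c * w₀ x with hwdef
  have hw : MemSob r w := (memSob_of_contDiffOn hr (hc₀ r)).const_mul c
  have hb : BoundaryCond r k w := by
    refine ⟨fun s _ => ?_, fun s _ => ?_⟩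
    · rw [hwdef, D_const_mul]
      simp only [hl₀, mul_ite, mul_one, mul_zero, c]
    · rw [hwdef, D_const_mul]
      simp only [hr₀, mul_zero]
  have hwN : nrm w ≤ δ / 2 := by rw [hwdef, nrm_const_mul, hcabs, one_mul]; exact hN₀
  set C := nrm (D r w)
  have hC : 0 ≤ C := nrm_nonneg _
  -- Chosen so that μ δ²/2 = C N + 1/2 exceeds the upper bound C N.
  set μ := (2 * (C * N) + 1) / δ ^ 2 with hμd
  have hμ : 0 < μ := by positivity
  have hu := isSolution_extremal hk hμ.le
  have hlu := hlow μ hμ.le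
  set u := extremal r k μ
  have h := hu.integral_D_mul_D hk hw.acUpTo hb
  rw [hu.D_D_left hk] at h
  have h1 := abs_integral_mul_le hw.memLp (hu.solvesEqn.memSob_D hr).memLp_self
  have h2 := abs_integral_mul_le hw.memLp_self
    (memLp_of_continuousOn (hu.solvesEqn.continuousOn hr))
  have h3 : ∫ x in (-1 : ℝ)..1, D r w x * D r u x ≤ C * N :=
    (le_abs_self _).trans (h1.trans (mul_le_mul_of_nonneg_left (hlt μ hμ.le).le hC))
  have h4 : ∫ x in (-1 : ℝ)..1, w x * u x ≤ δ / 2 * nrm u :=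
    (le_abs_self _).trans (h2.trans (mul_le_mul_of_nonneg_right hwN (nrm_nonneg u)))
  have h5 : δ ^ 2 / 2 ≤ nrm u ^ 2 - δ / 2 * nrm u := by nlinarith
  have h6 : μ * (δ ^ 2 / 2) = C * N + 1 / 2 := by rw [hμd]; field_simp
  have h7 := mul_le_mul_of_nonneg_left h4 hμ.le
  have h8 := mul_le_mul_of_nonneg_left h5 hμ.le
  have h9 := sq_nonneg (nrm (D r u))
  linarith

theorem exists_nrm_D_extremal_eq (hk : k < r) {N : ℝ≥0} (hN : markovConst r k ≤ N) :
    ∃ μ, 0 ≤ μ ∧ nrm (D r (extremal r k μ)) = N := by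
  have hlow : nrm (D r (extremal r k |0|)) ≤ N := by
    have := (nrm_D_extremal_zero_le hk).trans hN
    rw [abs_zero]
    rw [← ENNReal.ofReal_coe_nnreal] at this
    exact (ENNReal.ofReal_le_ofReal_iff N.2).1 this
  -- The level N + 1 is used because the lemma needs a positive one.
  obtain ⟨μ, hμ, hge⟩ := exists_le_nrm_D_extremal (r := r) hk (N := N + 1) (by positivity)
  rw [← abs_of_nonneg hμ] at hge
  obtain ⟨t, ht⟩ := mem_range_of_exists_le_of_exists_ge
    (continuous_nrm_D_extremal_abs (r := r) (k := k) (by omega)) ⟨0, hlow⟩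
    ⟨μ, (le_add_of_nonneg_right zero_le_one).trans hge⟩
  exact ⟨|t|, abs_nonneg t, ht⟩

end StechkinInterval

theorem mainTheorem3 (r k : ℕ) (hk : k < r) :
    -- the functions `u_μ`, `μ ≥ 0`, are well defined on `[-1, 1]`
    (∀ μ : ℝ, 0 ≤ μ → ∃ u, IsSolution r k μ u) ∧
    (∀ μ : ℝ, 0 ≤ μ → ∀ u v, IsSolution r k μ u → IsSolution r k μ v → Set.EqOn u v II) ∧
    -- the case `N < M_{-1}`
    (∀ N : ℝ≥0, (N : ℝ≥0∞) < markovConst r k → bestApprox r k N = ⊤) ∧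
    -- the case `N ≥ M_{-1}`
    (∀ N : ℝ≥0, markovConst r k ≤ N →
      (∃ μ : ℝ, 0 ≤ μ ∧ ∃ u, IsSolution r k μ u ∧ norm2 (D r u) = N) ∧
      ∀ μ : ℝ, 0 ≤ μ → ∀ u, IsSolution r k μ u → norm2 (D r u) = N →
        ∃ S : L2 →L[ℝ] ℝ, (∀ f : L2, S f = ∫ x in (-1 : ℝ)..1, D r u x * f x) ∧
          ‖S‖ ≤ N ∧
          bestApprox r k N = approxError r k S ∧
          approxError r k S = norm2 u) := by
  have hr : 1 ≤ r := by omega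
  have : NeZero (2 * r) := ⟨by omega⟩
  refine ⟨fun μ hμ => ⟨extremal r k μ, isSolution_extremal hk hμ⟩,
    fun μ hμ u v hu hv => hu.eqOn hk hμ hv, fun N hN => ?_, fun N hN => ⟨?_, ?_⟩⟩
  · refine eq_top_iff.2 (le_iInf₂ fun S hS => top_le_iff.2 ?_)
    by_contra htop
    refine absurd ((markovConst_le_enorm hr htop).trans ?_) (not_le.2 hN)
    rw [enorm_eq_nnnorm, ENNReal.coe_le_coe]
    exact hS
  · obtain ⟨μ, hμ, hμN⟩ := exists_nrm_D_extremal_eq hk hN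
    have hu := isSolution_extremal (r := r) hk hμ
    refine ⟨μ, hμ, _, hu, ?_⟩
    rw [norm2_eq (hu.solvesEqn.memSob_D hr).memLp_self, hμN, ENNReal.ofReal_coe_nnreal]
  · intro μ hμ u hu hN
    have hL := (hu.solvesEqn.memSob_D hr).memLp_self
    have hnN : nrm (D r u) = N := by
      rw [norm2_eq hL, ← ENNReal.ofReal_coe_nnreal] at hN
      exact (ENNReal.ofReal_eq_ofReal_iff (nrm_nonneg _) N.2).1 hN
    have hU := approxError_integralFunctional hk (hu.memSob.acUpTo.mono (by omega))
      (hu.solvesEqn.continuousOn hr) hL hu.boundaryCond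
    have hS : ‖integralFunctional hL‖ ≤ N := (norm_integralFunctional hL).trans_le hnN.le
    refine ⟨integralFunctional hL, integralFunctional_apply hL, hS, le_antisymm ?_ ?_, hU⟩
    · exact iInf₂_le (f := fun (S : L2 →L[ℝ] ℝ) (_ : ‖S‖ ≤ N) => approxError r k S) _ hS
    · rw [hU]
      exact le_iInf₂ fun S hS' => hu.nrm_le_approxError hk hμ (hS'.trans_eq hnN.symm)
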